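/- Let $\mathbb{D}^2=\{(z_1,z_2)\in\mathbb{C}^2 : |z_1|<1,\ |z_2|<1\}$, and let $\varphi$ be a Schur function on $\mathbb{D}^2$, that is, $\varphi:\mathbb{D}^2\to\mathbb{C}$ is analytic and $|\varphi(z)|\le 1$ for all $z\in\mathbb{D}^2$. Suppose there are complex Hilbert spaces $\mathcal{H}_1,\mathcal{H}_2$ and a bounded linear operator $$V=\begin{bmatrix} a&B\\ C&D\end{bmatrix}=\begin{bmatrix} a&B_1&B_2\\ C_1&D_1&D_2\\ C_2&0&D_3\end{bmatrix}:\ \mathbb{C}\oplus(\mathcal{H}_1\oplus\mathcal{H}_2)\to\mathbb{C}\oplus(\mathcal{H}_1\oplus\mathcal{H}_2)$$ (Hilbert space direct sums) such that 1. $V$ is an isometry; 2. $\varphi=\tau_V$ on $\mathbb{D}^2$, where $\tau_V(z)=a+B\,(I-E(z)D)^{-1}E(z)\,C$ and $E(z)=z_1I_{\mathcal{H}_1}\oplus z_2I_{\mathcal{H}_2}$; 3. $D_1$ and $D_3$ belong to $C_{0\cdot}$, i.e. $D_1$ and $D_3$ are contractions with $D_1^n h\to 0$ for every $h\in\mathcal{H}_1$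 and $D_3^n h\to0$ for every $h\in\mathcal{H}_2$, as $n\to\infty$. Then $\varphi$ is inner: for almost every $(t_1,t_2)\in(0,2\pi]^2$ (Lebesgue measure) the radial limit $\varphi(e^{it_1},e^{it_2}):=\lim_{r\nearrow1}\varphi(re^{it_1},re^{it_2})$ exists and $|\varphi(e^{it_1},e^{it_2})|=1$. -/

import Mathlib

open Set Filter Topology MeasureTheory

noncomputable section

namespace Bidisc

/-- The open unit bidisc. -/
def bidisc : Set (ℂ × ℂ) := {z | ‖z.1‖ < 1 ∧ ‖z.2‖ < 1}

/-- Schur functions on the bidisc: analytic and bounded by one in modulus. -/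
def IsSchur (φ : ℂ × ℂ → ℂ) : Prop :=
  AnalyticOnNhd ℂ φ bidisc ∧ ∀ z ∈ bidisc, ‖φ z‖ ≤ 1

/-- The point `(r e^{i t₁}, r e^{i t₂})`. -/
def radialPoint (r : ℝ) (t : ℝ × ℝ) : ℂ × ℂ :=
  ((r : ℂ) * Complex.exp (t.1 * Complex.I), (r : ℂ) * Complex.exp (t.2 * Complex.I))

/-- Inner functions on the bidisc: Schur functions whose radial boundary value exists and is
unimodular at almost every point of the torus (parametrized by angles, with Lebesgue measure). -/
def IsInner (φ : ℂ × ℂ → ℂ) : Prop :=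
  IsSchur φ ∧
    ∀ᵐ t : ℝ × ℝ ∂(volume.restrict (Ioc 0 (2 * Real.pi) ×ˢ Ioc 0 (2 * Real.pi))),
      ∃ ζ : ℂ, Tendsto (fun r : ℝ => φ (radialPoint r t)) (𝓝[<] 1) (𝓝 ζ) ∧ ‖ζ‖ = 1

/-- The class `C_{0·}`: contractions whose powers tend to zero in the strong operator topology. -/
def IsC0 {H : Type*} [NormedAddCommGroup H] [InnerProductSpace ℂ H] (T : H →L[ℂ] H) : Prop :=
  ‖T‖ ≤ 1 ∧ ∀ x : H, Tendsto (fun n : ℕ => (T ^ n) x) atTop (𝓝 0)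

section Blocks

variable {E F : Type*} [NormedAddCommGroup E] [InnerProductSpace ℂ E]
  [NormedAddCommGroup F] [InnerProductSpace ℂ F]

/-- The embedding of the first summand into the Hilbert space direct sum `E ⊕ F`. -/
def inl : E →L[ℂ] WithLp 2 (E × F) :=
  (WithLp.prodContinuousLinearEquiv 2 ℂ E F).symm.toContinuousLinearMap ∘L
    ContinuousLinearMap.inl ℂ E F

/-- The embedding of the second summand into `E ⊕ F`. -/
def inr : F →L[ℂ] WithLp 2 (E × F) :=
  (WithLp.prodContinuousLinearEquiv 2 ℂ E F).symm.toContinuousLinearMap ∘L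
    ContinuousLinearMap.inr ℂ E F

/-- The projection of `E ⊕ F` onto the first summand. -/
def fst : WithLp 2 (E × F) →L[ℂ] E := WithLp.fstL 2 ℂ E F

/-- The projection of `E ⊕ F` onto the second summand. -/
def snd : WithLp 2 (E × F) →L[ℂ] F := WithLp.sndL 2 ℂ E F

/-- The upper left entry of the `2 × 2` block matrix of an operator on `E ⊕ F`. -/
def block₁₁ (T : WithLp 2 (E × F) →L[ℂ] WithLp 2 (E × F)) : E →L[ℂ] E := fst ∘L T ∘L inl

/-- The upper right entry. -/
def block₁₂ (T : WithLp 2 (E × F) →L[ℂ] WithLp 2 (E × F)) : F →L[ℂ] E := fst ∘L T ∘L inr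

/-- The lower left entry. -/
def block₂₁ (T : WithLp 2 (E × F) →L[ℂ] WithLp 2 (E × F)) : E →L[ℂ] F := snd ∘L T ∘L inl

/-- The lower right entry. -/
def block₂₂ (T : WithLp 2 (E × F) →L[ℂ] WithLp 2 (E × F)) : F →L[ℂ] F := snd ∘L T ∘L inr

end Blocks

section Transfer

variable {H₁ H₂ : Type*} [NormedAddCommGroup H₁] [InnerProductSpace ℂ H₁]
  [NormedAddCommGroup H₂] [InnerProductSpace ℂ H₂]

/-- The operator `E(z) = z₁ I ⊕ z₂ I` on `H₁ ⊕ H₂`. -/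
def diagOp (z : ℂ × ℂ) : WithLp 2 (H₁ × H₂) →L[ℂ] WithLp 2 (H₁ × H₂) :=
  z.1 • (inl ∘L fst) + z.2 • (inr ∘L snd)

/-- The transfer function `τ_V(z) = a + B (I - E(z) D)⁻¹ E(z) C` of the colligation
`V = [[a, B], [C, D]]` on `ℂ ⊕ (H₁ ⊕ H₂)`. -/
def transfer
    (V : WithLp 2 (ℂ × WithLp 2 (H₁ × H₂)) →L[ℂ] WithLp 2 (ℂ × WithLp 2 (H₁ × H₂)))
    (z : ℂ × ℂ) : ℂ :=
  block₁₁ V 1 +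
    block₁₂ V ((Ring.inverse (1 - diagOp z * block₂₂ V) :
      WithLp 2 (H₁ × H₂) →L[ℂ] WithLp 2 (H₁ × H₂)) (diagOp z (block₂₁ V 1)))

/-- For an isometric `V` and `z` in the bidisc, the inverse in `transfer` is a genuine one. -/
theorem isUnit_one_sub_diagOp_mul [CompleteSpace H₁] [CompleteSpace H₂]
    (V : WithLp 2 (ℂ × WithLp 2 (H₁ × H₂)) →L[ℂ] WithLp 2 (ℂ × WithLp 2 (H₁ × H₂)))
    (hV : Isometry V) {z : ℂ × ℂ} (hz : z ∈ bidisc) :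
    IsUnit (1 - diagOp z * block₂₂ V) := by
  have hVn : ∀ x, ‖V x‖ = ‖x‖ := (AddMonoidHomClass.isometry_iff_norm V).1 hV
  have hD : ∀ x, ‖block₂₂ V x‖ ≤ ‖x‖ := by
    intro x
    have h1 := hVn (inr x)
    have h2 : ‖(inr x : WithLp 2 (ℂ × WithLp 2 (H₁ × H₂)))‖ = ‖x‖ := by
      simp [inr]
    have h3 := WithLp.prod_norm_sq_eq_of_L2 (V (inr x))
    have h4 : block₂₂ V x = (V (inr x)).snd := rfl
    rw [h4]
    refine abs_le_of_sq_le_sq' ?_ (norm_nonneg _) |>.2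
    rw [← h2, ← h1, h3]
    nlinarith [sq_nonneg ‖(V (inr x)).fst‖]
  set m : ℝ := max ‖z.1‖ ‖z.2‖ with hm
  have hm0 : 0 ≤ m := le_max_of_le_left (norm_nonneg _)
  have hE : ∀ x : WithLp 2 (H₁ × H₂), ‖diagOp z x‖ ≤ m * ‖x‖ := by
    intro x
    have h1 := WithLp.prod_norm_sq_eq_of_L2 (diagOp z x)
    have h2 := WithLp.prod_norm_sq_eq_of_L2 x
    have e1 : (diagOp z x).fst = z.1 • x.fst := by simp [diagOp, inl, inr, fst, snd]
    have e2 : (diagOp z x).snd = z.2 • x.snd := by simp [diagOp, inl, inr, fst, snd]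
    rw [e1, e2, norm_smul, norm_smul] at h1
    have a1 : ‖z.1‖ * ‖x.fst‖ ≤ m * ‖x.fst‖ := by gcongr; exact le_max_left _ _
    have a2 : ‖z.2‖ * ‖x.snd‖ ≤ m * ‖x.snd‖ := by gcongr; exact le_max_right _ _
    refine abs_le_of_sq_le_sq' ?_ (by positivity) |>.2
    rw [h1, mul_pow m, h2, mul_add, ← mul_pow m, ← mul_pow m]
    gcongr
  have hlt : ‖diagOp z * block₂₂ V‖ < 1 := by
    refine lt_of_le_of_lt (ContinuousLinearMap.opNorm_le_bound _ hm0 fun x => ?_)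
      (max_lt hz.1 hz.2)
    exact (hE _).trans (by gcongr; exact hD x)
  exact isUnit_one_sub_of_norm_lt_one hlt

end Transfer

end Bidisc

end

/-! Feeding `(1, h)` into the isometry, where `h = E(z) f` and `f = C + D h`, returns `(φ(z), f)`.
Comparing norms gives the energy balance 1 - |φ|² = (1 - |z₁|²) ‖f₁‖² + (1 - |z₂|²) ‖f₂‖². Because
`D` is block upper triangular, f₂ = (1 - z₂D₃)⁻¹C₂ depends on z₂ alone, and for fixed z₂ the vector
f₁ is the resolvent of D₁ at z₁ applied to a fixed vector (`one_sub_norm_transfer_sq`).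

By Parseval, the mean of (1 - r²) ‖(1 - zT)⁻¹y‖² over |z| = r is an Abel mean of ‖Tⁿy‖², so it tends
to zero when T is of class C_{0·} (`IsC0.tendsto_integral_neumann`). Letting the first radius tend
to 1 with the second fixed removes the f₁ term; letting the second tend to 1 then removes the f₂
term. Hence the integral of 1 - |φ|² over tori of suitable polyradii is arbitrarily small
(`exists_totalDefect_lt`).

This integral decreases in each radius (`totalDefect_anti`), so it also tends to zero along equal
radii. Radial limits exist almost everywhere by Fatou's theorem on the discs z ↦ (z, e^{iu}z) and
Fubini (`ae_exists_radial_limit_of_isSchur`). By dominated convergence the nonnegative boundary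
function 1 - |φ|² has integral zero. -/

namespace Bidisc

/-! ### Fatou's theorem on the disc -/

/-- The reflected derivative of the Cauchy kernel is controlled by the Poisson kernel. -/
theorem norm_reflected_kernel_le {r : ℝ} (h0 : 0 ≤ r) (h1 : r < 1) {w : ℂ} (hw : ‖w‖ = 1) :
    ‖((w - r) ^ 2)⁻¹ - ((1 - r * w) ^ 2)⁻¹‖ ≤ 4 * (1 - r) * ‖w - 1‖ / ‖w - r‖ ^ 4 := by
  have hn : ‖(1 - r * w : ℂ)‖ = ‖w - r‖ := by
    have e : (1 - r * w : ℂ) = w * (starRingEnd ℂ) (w - r) := by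
      have : w * (starRingEnd ℂ) w = 1 := by
        rw [Complex.mul_conj, Complex.normSq_eq_norm_sq, hw]; simp
      rw [map_sub, mul_sub, this, Complex.conj_ofReal, mul_comm w]
    rw [e, norm_mul, hw, one_mul, RCLike.norm_conj]
  have hpos : 0 < ‖w - r‖ := by
    rw [norm_pos_iff, sub_ne_zero]
    rintro rfl
    simp [abs_of_nonneg h0] at hw
    linarith
  have hne : (w - r : ℂ) ≠ 0 := norm_pos_iff.1 hpos
  have hne' : (1 - r * w : ℂ) ≠ 0 := norm_pos_iff.1 (hn ▸ hpos)
  -- The numerator is (1 - rw)² - (w - r)² = (1 - r²)(1 - w²): reflection gains both a factor 1 - r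
  -- and a factor w - 1.
  have e : ((w - r) ^ 2)⁻¹ - ((1 - r * w) ^ 2)⁻¹
      = ((1 + r) * (1 - r) * (1 + w)) * (1 - w) / ((w - r) ^ 2 * (1 - r * w) ^ 2) := by
    rw [inv_sub_inv (pow_ne_zero _ hne) (pow_ne_zero _ hne')]
    ring
  rw [e, norm_div, norm_mul, norm_mul, norm_mul, norm_mul, norm_pow, norm_pow, hn, ← pow_add,
    norm_sub_rev 1 w]
  have a1 : ‖(1 + r : ℂ)‖ ≤ 2 := by
    refine (norm_add_le _ _).trans ?_
    simp [abs_of_nonneg h0]; linarith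
  have a2 : ‖(1 - r : ℂ)‖ = 1 - r := by
    rw [← Complex.ofReal_one, ← Complex.ofReal_sub, Complex.norm_real, Real.norm_eq_abs,
      abs_of_nonneg (by linarith)]
  have a3 : ‖1 + w‖ ≤ 2 := by
    refine (norm_add_le _ _).trans ?_
    rw [hw]; norm_num
  rw [a2]
  refine div_le_div_of_nonneg_right (mul_le_mul_of_nonneg_right ?_ (norm_nonneg _)) (by positivity)
  calc ‖(1 + r : ℂ)‖ * (1 - r) * ‖1 + w‖ ≤ 2 * (1 - r) * 2 := by
        gcongr
    _ = 4 * (1 - r) := by ring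

/-- Cauchy's formula for the derivative of a function continuous up to the boundary, with the
reflected kernel. -/
theorem circleIntegral_reflected_kernel {Q : ℂ → ℂ} (hQ : DiffContOnCl ℂ Q (Metric.ball 0 1))
    {r : ℝ} (h0 : 0 ≤ r) (h1 : r < 1) :
    ∮ w in C(0, 1), (((w - r) ^ 2)⁻¹ - ((1 - r * w) ^ 2)⁻¹) * Q w
      = 2 * Real.pi * Complex.I * deriv Q r := by
  have hr : (r : ℂ) ∈ Metric.ball (0 : ℂ) 1 := by simp [abs_of_nonneg h0, h1]
  have hnb : Metric.ball (0 : ℂ) 1 ∈ 𝓝 (r : ℂ) := Metric.isOpen_ball.mem_nhds hr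
  have hcl : closure (Metric.ball (0 : ℂ) 1) = Metric.closedBall 0 1 :=
    closure_ball _ one_ne_zero
  have hQc : ContinuousOn Q (Metric.closedBall 0 1) := hcl ▸ hQ.continuousOn
  -- Cauchy's formula is applied at r to the difference quotient of Q, whose value there is the
  -- derivative. The constant Q(r) drops out because (w - r)⁻² has integral zero.
  have hd : DiffContOnCl ℂ (dslope Q (r : ℂ)) (Metric.ball 0 1) := by
    refine ⟨(Complex.differentiableOn_dslope hnb).2 hQ.differentiableOn, ?_⟩
    rw [hcl]
    exact (continuousOn_dslope (mem_of_superset hnb Metric.ball_subset_closedBall)).2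
      ⟨hQc, hQ.differentiableOn.differentiableAt hnb⟩
  have k1 := hd.circleIntegral_sub_inv_smul hr
  have hsp : ∀ w ∈ Metric.sphere (0 : ℂ) 1, w - r ≠ 0 := by
    intro w hw h
    rw [sub_eq_zero] at h
    subst h
    simp [abs_of_nonneg h0] at hw
    linarith
  have hball : ∀ w ∈ Metric.closedBall (0 : ℂ) 1, (1 - r * w : ℂ) ≠ 0 := by
    intro w hw h
    have : ‖(r * w : ℂ)‖ = 1 := by rw [← sub_eq_zero.1 h]; simp
    rw [norm_mul, Complex.norm_real, Real.norm_eq_abs, abs_of_nonneg h0] at this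
    have hw' : ‖w‖ ≤ 1 := by simpa using hw
    nlinarith
  -- The pole 1/r lies outside the closed disc, so subtracting the reflected kernel costs nothing.
  have k2 : ∮ w in C(0, 1), ((1 - r * w) ^ 2)⁻¹ * Q w = 0 := by
    refine DiffContOnCl.circleIntegral_eq_zero zero_le_one ⟨?_, ?_⟩
    · refine DifferentiableOn.mul (DifferentiableOn.inv (by fun_prop) ?_) hQ.differentiableOn
      exact fun w hw => pow_ne_zero _ (hball w (Metric.ball_subset_closedBall hw))
    · rw [hcl]
      refine ContinuousOn.mul (ContinuousOn.inv₀ (by fun_prop) ?_) hQc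
      exact fun w hw => pow_ne_zero _ (hball w hw)
  have k3 : ∮ w in C(0, 1), ((w - r) ^ 2)⁻¹ = 0 := by
    have := circleIntegral.integral_sub_zpow_of_ne (n := -2) (by norm_num) 0 (r : ℂ) 1
    simpa [zpow_neg] using this
  have c1 : CircleIntegrable (fun w => ((w - r) ^ 2)⁻¹ * Q w) 0 1 := by
    refine ContinuousOn.circleIntegrable zero_le_one ?_
    refine ContinuousOn.mul (ContinuousOn.inv₀ (by fun_prop) ?_)
      (hQc.mono Metric.sphere_subset_closedBall)
    exact fun w hw => pow_ne_zero _ (hsp w hw)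
  have c3 : CircleIntegrable (fun w => ((w - r) ^ 2)⁻¹ * Q r) 0 1 := by
    refine ContinuousOn.circleIntegrable zero_le_one ?_
    refine ContinuousOn.mul (ContinuousOn.inv₀ (by fun_prop) ?_) continuousOn_const
    exact fun w hw => pow_ne_zero _ (hsp w hw)
  have c2 : CircleIntegrable (fun w => ((1 - r * w) ^ 2)⁻¹ * Q w) 0 1 := by
    refine ContinuousOn.circleIntegrable zero_le_one ?_
    refine ContinuousOn.mul (ContinuousOn.inv₀ (by fun_prop) ?_)
      (hQc.mono Metric.sphere_subset_closedBall)
    exact fun w hw => pow_ne_zero _ (hball w (Metric.sphere_subset_closedBall hw))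
  have k4 : ∮ w in C(0, 1), ((w - r) ^ 2)⁻¹ * Q w = 2 * Real.pi * Complex.I * deriv Q r := by
    have e : ∮ w in C(0, 1), (w - r)⁻¹ • dslope Q (r : ℂ) w
        = ∮ w in C(0, 1), (((w - r) ^ 2)⁻¹ * Q w - ((w - r) ^ 2)⁻¹ * Q r) := by
      refine circleIntegral.integral_congr zero_le_one fun w hw => ?_
      have := hsp w hw
      rw [dslope_of_ne _ (sub_ne_zero.1 this), slope_def_field, smul_eq_mul]
      field_simp
    rw [e, circleIntegral.integral_sub c1 c3] at k1
    have : ∮ w in C(0, 1), ((w - r) ^ 2)⁻¹ * Q r = 0 := by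
      have := circleIntegral.integral_smul_const (fun w : ℂ => ((w - r) ^ 2)⁻¹) (Q r) 0 1
      simp only [smul_eq_mul] at this
      rw [this, k3, zero_mul]
    rw [this, sub_zero, dslope_same] at k1
    simpa using k1
  simp only [sub_mul]
  rw [circleIntegral.integral_sub c1 c2, k2, k4, sub_zero]

/-- If `Q` is small of order one at the boundary point `1`, then its derivative has radial limit
zero there. -/
theorem tendsto_deriv_radial_zero {Q : ℂ → ℂ} (hQ : DiffContOnCl ℂ Q (Metric.ball 0 1))
    (hb : ∀ ε > 0, ∃ M, ∀ w : ℂ, ‖w‖ = 1 → ‖Q w‖ ≤ ε * ‖w - 1‖ + M * ‖w - 1‖ ^ 3) :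
    Tendsto (fun r : ℝ => deriv Q r) (𝓝[<] 1) (𝓝 0) := by
  have key : ∀ ε > 0, ∃ M ≥ 0, ∀ r : ℝ, 0 ≤ r → r < 1 →
      ‖deriv Q r‖ ≤ 16 * ε + M * (1 - r) := by
    intro ε hε
    obtain ⟨M₀, hM₀⟩ := hb ε hε
    set M := max M₀ 0
    have hM : ∀ w : ℂ, ‖w‖ = 1 → ‖Q w‖ ≤ ε * ‖w - 1‖ + M * ‖w - 1‖ ^ 3 := fun w hw =>
      (hM₀ w hw).trans (by gcongr; exact le_max_left _ _)
    have hM0 : 0 ≤ M := le_max_right _ _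
    refine ⟨64 * M, by positivity, fun r h0 h1 => ?_⟩
    have hr : (r : ℂ) ∈ Metric.ball (0 : ℂ) 1 := by simp [abs_of_nonneg h0, h1]
    have hP := DiffContOnCl.circleAverage_poissonKernel_smul' (f := fun _ => (1 : ℂ))
      diffContOnCl_const hr
    have hP' : ∫ θ in (0 : ℝ)..2 * Real.pi, (1 - r ^ 2) / ‖circleMap 0 1 θ - r‖ ^ 2
        = 2 * Real.pi := by
      rw [Real.circleAverage_def, inv_smul_eq_iff₀ (by positivity)] at hP
      have e : (fun θ : ℝ => ((‖circleMap 0 1 θ - 0‖ ^ 2 - ‖(r : ℂ) - 0‖ ^ 2)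
          / ‖(circleMap 0 1 θ - 0) - ((r : ℂ) - 0)‖ ^ 2) • (1 : ℂ))
          = fun θ : ℝ => (((1 - r ^ 2) / ‖circleMap 0 1 θ - r‖ ^ 2 : ℝ) : ℂ) := by
        funext θ
        simp
      rw [e, intervalIntegral.integral_ofReal] at hP
      have := congrArg Complex.re hP
      simpa using this
    have hne : ∀ θ : ℝ, 0 < ‖circleMap 0 1 θ - r‖ := by
      intro θ
      rw [norm_pos_iff, sub_ne_zero]
      intro h
      have := congrArg norm h
      simp [abs_of_nonneg h0] at this
      linarith
    have hbd : ∀ θ : ℝ, ‖deriv (circleMap 0 1) θ • ((((circleMap 0 1 θ - r) ^ 2)⁻¹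
        - ((1 - r * circleMap 0 1 θ) ^ 2)⁻¹) * Q (circleMap 0 1 θ))‖
        ≤ 16 * ε * ((1 - r ^ 2) / ‖circleMap 0 1 θ - r‖ ^ 2) + 64 * M * (1 - r) := by
      intro θ
      have hw : ‖circleMap 0 1 θ‖ = 1 := by simp
      have hρ := hne θ
      have hd : ‖deriv (circleMap 0 1) θ‖ = 1 := by simp
      rw [norm_smul, hd, one_mul, norm_mul]
      refine (mul_le_mul (norm_reflected_kernel_le h0 h1 hw) (hM _ hw) (norm_nonneg _)
        (div_nonneg (mul_nonneg (by linarith) (norm_nonneg _)) (by positivity))).trans ?_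
      -- The distance from r to the circle is 1 - r, so |w - 1| ≤ |w - r| + (1 - r) ≤ 2|w - r|. The
      -- linear part of the bound on Q then costs a multiple of the Poisson kernel, and the cubic
      -- part only O(1 - r).
      have hd2 : ‖circleMap 0 1 θ - 1‖ ≤ 2 * ‖circleMap 0 1 θ - r‖ := by
        have t1 := norm_sub_le_norm_sub_add_norm_sub (circleMap 0 1 θ) (r : ℂ) 1
        have t2 : ‖(r : ℂ) - 1‖ = 1 - r := by
          rw [← Complex.ofReal_one, ← Complex.ofReal_sub, Complex.norm_real, Real.norm_eq_abs,
            abs_sub_comm, abs_of_nonneg (by linarith)]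
        have t3 := norm_sub_norm_le (circleMap 0 1 θ) (r : ℂ)
        rw [hw, Complex.norm_real, Real.norm_eq_abs, abs_of_nonneg h0] at t3
        linarith
      generalize ‖circleMap 0 1 θ - r‖ = ρ at *
      have hd0 := norm_nonneg (circleMap 0 1 θ - 1)
      generalize ‖circleMap 0 1 θ - 1‖ = d at *
      have e1 : 4 * (1 - r) * d / ρ ^ 4 * (ε * d + M * d ^ 3)
          = 4 * (1 - r) * (ε * (d ^ 2 / ρ ^ 4) + M * (d ^ 4 / ρ ^ 4)) := by
        field_simp
      have e2 : d ^ 2 / ρ ^ 4 ≤ 4 / ρ ^ 2 := by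
        rw [div_le_div_iff₀ (by positivity) (by positivity)]
        have : d ^ 2 ≤ (2 * ρ) ^ 2 := by gcongr
        nlinarith [mul_le_mul_of_nonneg_right this (sq_nonneg ρ)]
      have e3 : d ^ 4 / ρ ^ 4 ≤ 16 := by
        rw [div_le_iff₀ (by positivity)]
        have : d ^ 4 ≤ (2 * ρ) ^ 4 := by gcongr
        linarith
      have h1' : 0 ≤ 1 - r := by linarith
      rw [e1]
      calc 4 * (1 - r) * (ε * (d ^ 2 / ρ ^ 4) + M * (d ^ 4 / ρ ^ 4))
          ≤ 4 * (1 - r) * (ε * (4 / ρ ^ 2) + M * 16) := by gcongr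
        _ = 16 * ε * ((1 - r) / ρ ^ 2) + 64 * M * (1 - r) := by ring
        _ ≤ 16 * ε * ((1 - r ^ 2) / ρ ^ 2) + 64 * M * (1 - r) := by
          gcongr
          nlinarith
    have hcont : Continuous fun θ : ℝ => (1 - r ^ 2) / ‖circleMap 0 1 θ - r‖ ^ 2 :=
      continuous_const.div (((continuous_circleMap 0 1).sub continuous_const).norm.pow 2)
        fun θ => (pow_pos (hne θ) 2).ne'
    have hI := intervalIntegral.norm_integral_le_of_norm_le (μ := volume)
      Real.two_pi_pos.le (Eventually.of_forall fun θ _ => hbd θ)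
      (((hcont.const_mul _).add continuous_const).intervalIntegrable _ _)
    rw [intervalIntegral.integral_add ((hcont.const_mul _).intervalIntegrable _ _)
      intervalIntegrable_const, intervalIntegral.integral_const_mul, hP',
      intervalIntegral.integral_const] at hI
    have hC := circleIntegral_reflected_kernel hQ h0 h1
    rw [circleIntegral] at hC
    rw [hC, norm_mul] at hI
    have hpi := Real.pi_pos
    have e4 : ‖(2 * Real.pi * Complex.I : ℂ)‖ = 2 * Real.pi := by
      simp [abs_of_pos hpi]
    rw [e4, smul_eq_mul, sub_zero] at hI
    refine le_of_mul_le_mul_left (hI.trans (le_of_eq ?_)) Real.two_pi_pos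
    ring
  rw [Metric.tendsto_nhds]
  intro ε hε
  obtain ⟨M, hM, hle⟩ := key (ε / 32) (by positivity)
  have h1 : Tendsto (fun r : ℝ => 16 * (ε / 32) + M * (1 - r)) (𝓝[<] 1) (𝓝 (ε / 2)) := by
    have : Tendsto (fun r : ℝ => 16 * (ε / 32) + M * (1 - r)) (𝓝 1)
        (𝓝 (16 * (ε / 32) + M * (1 - 1))) := Continuous.tendsto (by fun_prop) _
    refine (this.mono_left nhdsWithin_le_nhds).trans (le_of_eq ?_)
    congr 1; ring
  filter_upwards [h1.eventually_lt_const (half_lt_self hε), self_mem_nhdsWithin,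
    mem_nhdsWithin_of_mem_nhds (lt_mem_nhds zero_lt_one)] with r a b c
  rw [dist_zero_right]
  exact (hle r (le_of_lt c) b).trans_lt a

/-- A Lipschitz function on the circle whose derivative along the circle vanishes at `1` satisfies
a cubic bound up to an arbitrarily small linear term. -/
theorem cubic_bound_of_hasDerivAt_zero {Q : ℂ → ℂ} {K : ℝ} (hK : 0 ≤ K)
    (hL : ∀ w, ‖Q w‖ ≤ K * ‖w - 1‖)
    (hd : HasDerivAt (fun θ : ℝ => Q (Complex.exp (θ * Complex.I))) 0 0) {ε : ℝ} (hε : 0 < ε) :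
    ∃ M, ∀ w : ℂ, ‖w‖ = 1 → ‖Q w‖ ≤ ε * ‖w - 1‖ + M * ‖w - 1‖ ^ 3 := by
  have hQ1 : Q 1 = 0 := by simpa using hL 1
  have ho : (fun θ : ℝ => Q (Complex.exp (θ * Complex.I))) =o[𝓝 0] fun θ : ℝ => θ := by
    have := hasDerivAt_iff_isLittleO.1 hd
    simpa [hQ1] using this
  have harg : Tendsto Complex.arg (𝓝 1) (𝓝 0) := by
    have := (Complex.continuousAt_arg (x := 1) (by simp)).tendsto
    rwa [Complex.arg_one] at this
  have hO : Complex.arg =O[𝓝 1] fun w : ℂ => w - 1 := by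
    have h1 := (Complex.hasDerivAt_log (z := 1) (by simp)).isBigO_sub
    simp only [Complex.log_one, sub_zero] at h1
    refine (Asymptotics.IsBigO.of_bound 1 (Eventually.of_forall fun w => ?_)).trans h1
    rw [one_mul, Real.norm_eq_abs, ← Complex.log_im]
    exact Complex.abs_im_le_norm _
  have h2 := (ho.comp_tendsto harg).trans_isBigO hO
  obtain ⟨δ, hδ, hball⟩ := Metric.eventually_nhds_iff.1 (h2.def hε)
  -- At distance at least δ from 1, the cubic term with this coefficient dominates the Lipschitz
  -- bound; closer in, differentiability supplies the linear term.
  refine ⟨K / δ ^ 2, fun w hw => ?_⟩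
  have hMnn : 0 ≤ K / δ ^ 2 * ‖w - 1‖ ^ 3 := by positivity
  by_cases hwδ : dist w 1 < δ
  · have h3 := hball hwδ
    have h4 : Complex.exp (Complex.arg w * Complex.I) = w := by
      have := Complex.norm_mul_exp_arg_mul_I w
      rwa [hw, Complex.ofReal_one, one_mul] at this
    simp only [Function.comp_apply, h4] at h3
    linarith
  · rw [not_lt, dist_eq_norm] at hwδ
    have h5 : K * ‖w - 1‖ ≤ K / δ ^ 2 * ‖w - 1‖ ^ 3 := by
      rw [div_mul_eq_mul_div, le_div_iff₀ (by positivity)]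
      have : δ ^ 2 ≤ ‖w - 1‖ ^ 2 := by gcongr
      nlinarith [mul_le_mul_of_nonneg_left this (mul_nonneg hK (norm_nonneg (w - 1)))]
    have : 0 ≤ ε * ‖w - 1‖ := by positivity
    linarith [hL w]

/-- **Fatou's theorem**: a bounded holomorphic function on the unit disc has radial limits almost
everywhere. -/
theorem ae_exists_radial_limit {g : ℂ → ℂ} (hg : DifferentiableOn ℂ g (Metric.ball 0 1))
    (hb : ∀ z ∈ Metric.ball (0 : ℂ) 1, ‖g z‖ ≤ 1) :
    ∀ᵐ t : ℝ, ∃ ζ : ℂ, Tendsto (fun r : ℝ => g (r * Complex.exp (t * Complex.I)))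
      (𝓝[<] 1) (𝓝 ζ) := by
  -- A primitive of g is Lipschitz because g is bounded. Its Lipschitz extension restricts to the
  -- circle as a function differentiable almost everywhere, and g has a radial limit at each such
  -- point.
  obtain ⟨F, hF⟩ := hg.isExactOn_ball
  have hlip : LipschitzOnWith 1 F (Metric.ball 0 1) :=
    (convex_ball (0 : ℂ) 1).lipschitzOnWith_of_nnnorm_hasDerivWithin_le
      (fun z hz => (hF z hz).hasDerivWithinAt) fun z hz => by
        simpa [← NNReal.coe_le_coe] using hb z hz
  obtain ⟨G, hG, hFG⟩ := hlip.extend_finite_dimension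
  set K : NNReal := lipschitzExtensionConstant ℂ * 1
  have hGd : ∀ z ∈ Metric.ball (0 : ℂ) 1, HasDerivAt G (g z) z := fun z hz =>
    (hF z hz).congr_of_eventuallyEq
      (eventually_of_mem (Metric.isOpen_ball.mem_nhds hz) fun x hx => (hFG hx).symm)
  have hexp : LipschitzWith 1 fun θ : ℝ => Complex.exp (θ * Complex.I) := by
    refine LipschitzWith.of_dist_le_mul fun x y => ?_
    rw [dist_eq_norm]
    simpa [circleMap, dist_eq_norm] using (lipschitzWith_circleMap 0 1).dist_le_mul x y
  filter_upwards [(hG.comp hexp).ae_differentiableAt_real] with t ht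
  set u := Complex.exp (t * Complex.I) with hu
  have hun : ‖u‖ = 1 := Complex.norm_exp_ofReal_mul_I t
  obtain ⟨d, hd⟩ : ∃ d, HasDerivAt (fun θ : ℝ => G (Complex.exp (θ * Complex.I))) d t :=
    ⟨_, ht.hasDerivAt⟩
  -- The curve θ ↦ e^{iθ} has velocity i at θ = 0, so this slope cancels the tangential derivative.
  -- Since Q′(r) = u g(ur) - c, the radial limit must be c / u.
  set c : ℂ := d / Complex.I with hc
  set Q : ℂ → ℂ := fun z => G (u * z) - G u - c * (z - 1) with hQ
  have hmem : ∀ z ∈ Metric.ball (0 : ℂ) 1, u * z ∈ Metric.ball (0 : ℂ) 1 := fun z hz => by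
    simpa [hun] using hz
  have hQd : ∀ z ∈ Metric.ball (0 : ℂ) 1, HasDerivAt Q (g (u * z) * u - c) z := by
    intro z hz
    have h1 : HasDerivAt (fun z => u * z) u z := by simpa using (hasDerivAt_id z).const_mul u
    have h2 := ((hGd _ (hmem z hz)).comp z h1).sub_const (G u)
    have h3 : HasDerivAt (fun z => c * (z - 1)) c z := by
      simpa using ((hasDerivAt_id z).sub_const 1).const_mul c
    exact h2.sub h3
  have hQc : Continuous Q := by
    have := hG.continuous
    fun_prop
  have hQcl : DiffContOnCl ℂ Q (Metric.ball 0 1) :=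
    ⟨fun z hz => (hQd z hz).differentiableAt.differentiableWithinAt, hQc.continuousOn⟩
  have hQl : ∀ w, ‖Q w‖ ≤ (K + ‖c‖) * ‖w - 1‖ := by
    intro w
    have h1 := hG.dist_le_mul (u * w) u
    have h2 : u * w - u = u * (w - 1) := by ring
    rw [dist_eq_norm, dist_eq_norm, h2, norm_mul, hun, one_mul] at h1
    refine (norm_sub_le _ _).trans ?_
    rw [norm_mul, add_mul]
    gcongr
  have hQt : HasDerivAt (fun θ : ℝ => Q (Complex.exp (θ * Complex.I))) 0 0 := by
    have h1 : HasDerivAt (fun θ : ℝ => G (u * Complex.exp (θ * Complex.I))) d 0 := by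
      have := HasDerivAt.comp_const_add (f := fun θ : ℝ => G (Complex.exp (θ * Complex.I))) t 0
        (by simpa using hd)
      refine this.congr_of_eventuallyEq (Eventually.of_forall fun θ => ?_)
      simp only [hu]
      rw [← Complex.exp_add]
      push_cast
      rw [add_mul]
    have h2 : HasDerivAt (fun θ : ℝ => Complex.exp (θ * Complex.I)) Complex.I 0 := by
      have := ((Complex.hasDerivAt_exp (((0 : ℝ) : ℂ) * Complex.I)).comp (0 : ℝ)
        ((Complex.ofRealCLM.hasDerivAt (x := 0)).mul_const Complex.I))
      simpa [Function.comp_def] using this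
    have h3 := (h1.sub_const (G u)).sub ((h2.sub_const 1).const_mul c)
    rwa [hc, div_mul_cancel₀ _ Complex.I_ne_zero, sub_self] at h3
  have hlim := tendsto_deriv_radial_zero hQcl fun ε hε =>
    cubic_bound_of_hasDerivAt_zero (by positivity) hQl hQt hε
  have hu0 : u ≠ 0 := Complex.exp_ne_zero _
  refine ⟨c / u, ?_⟩
  have h4 := (hlim.add_const c).div_const u
  rw [zero_add] at h4
  refine h4.congr' ?_
  filter_upwards [self_mem_nhdsWithin, mem_nhdsWithin_of_mem_nhds (lt_mem_nhds zero_lt_one)]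
    with r b a
  have hr : (r : ℂ) ∈ Metric.ball (0 : ℂ) 1 := by
    have a' : (0 : ℝ) < r := a
    have b' : r < 1 := b
    simp [abs_of_pos a', b']
  rw [(hQd _ hr).deriv, sub_add_cancel, mul_div_cancel_right₀ _ hu0, mul_comm]

/-! ### Radial limits on the bidisc -/

/-- A left limit at `1` can be detected along the rationals. -/
theorem exists_tendsto_iff_along_rat {h : ℝ → ℂ} (hc : ContinuousOn h (Ioo 0 1)) :
    (∃ ζ, Tendsto h (𝓝[<] 1) (𝓝 ζ)) ↔
      ∃ ζ, Tendsto (fun q : ℚ => h q) (comap (fun q : ℚ => (q : ℝ)) (𝓝[<] 1)) (𝓝 ζ) := by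
  refine ⟨fun ⟨ζ, hζ⟩ => ⟨ζ, hζ.comp tendsto_comap⟩, fun ⟨ζ, hζ⟩ => ⟨ζ, ?_⟩⟩
  rw [Metric.tendsto_nhds] at hζ ⊢
  intro ε hε
  have h1 := eventually_comap.1 (hζ (ε / 2) (half_pos hε))
  obtain ⟨a, ha, hsub⟩ := mem_nhdsLT_iff_exists_Ioo_subset.1 h1
  filter_upwards [Ioo_mem_nhdsLT (max_lt ha zero_lt_one)] with r hr
  have hra : a < r := (le_max_left _ _).trans_lt hr.1
  have hr0 : 0 < r := (le_max_right _ _).trans_lt hr.1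
  by_contra hcon
  rw [not_lt] at hcon
  -- A value far from ζ at a real r would persist at nearby rationals, contradicting the limit along
  -- them.
  have hca : ContinuousAt h r := hc.continuousAt (Ioo_mem_nhds hr0 hr.2)
  have h2 : ∀ᶠ s in 𝓝 r, ε / 2 < dist (h s) ζ :=
    (hca.dist continuousAt_const).eventually (lt_mem_nhds (by linarith))
  obtain ⟨q, hq⟩ := Rat.denseRange_cast.mem_nhds (h2.and (Ioo_mem_nhds hra hr.2))
  exact absurd (hsub hq.2 q rfl) hq.1.not_gt

theorem torus_mem_bidisc {r s : ℝ} (hr : |r| < 1) (hs : |s| < 1) (a b : ℝ) :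
    ((r * Complex.exp (a * Complex.I), s * Complex.exp (b * Complex.I)) : ℂ × ℂ) ∈ bidisc := by
  constructor <;> simpa [Complex.norm_exp_ofReal_mul_I]

theorem radialPoint_mem_bidisc {r : ℝ} (hr : |r| < 1) (t : ℝ × ℝ) : radialPoint r t ∈ bidisc :=
  torus_mem_bidisc hr hr _ _

/-- Schur functions on the bidisc have radial limits almost everywhere on the torus. -/
theorem ae_exists_radial_limit_of_isSchur {φ : ℂ × ℂ → ℂ} (hφ : IsSchur φ) :
    ∀ᵐ t : ℝ × ℝ, ∃ ζ : ℂ, Tendsto (fun r : ℝ => φ (radialPoint r t)) (𝓝[<] 1) (𝓝 ζ) := by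
  have hcont : ContinuousOn φ bidisc := hφ.1.continuousOn
  set S : Set (ℝ × ℝ) :=
    {t | ∃ ζ : ℂ, Tendsto (fun r : ℝ => φ (radialPoint r t)) (𝓝[<] 1) (𝓝 ζ)} with hS
  -- Restricting to rational radii leaves countably many functions. The default value 0 for |q| ≥ 1
  -- makes each of them continuous and does not affect the limit.
  have hSm : MeasurableSet S := by
    have e : S = {t | ∃ ζ : ℂ, Tendsto
        (fun q : ℚ => if |(q : ℝ)| < 1 then φ (radialPoint q t) else 0)
        (comap (fun q : ℚ => (q : ℝ)) (𝓝[<] 1)) (𝓝 ζ)} := by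
      ext t
      have hc : ContinuousOn (fun r : ℝ => φ (radialPoint r t)) (Ioo 0 1) := by
        refine hcont.comp (Continuous.continuousOn ?_) fun r hr => radialPoint_mem_bidisc ?_ t
        · unfold radialPoint; fun_prop
        · rw [abs_of_pos hr.1]; exact hr.2
      rw [hS, mem_ofPred_eq, mem_ofPred_eq, exists_tendsto_iff_along_rat hc]
      refine exists_congr fun ζ => tendsto_congr' ?_
      refine Eventually.comap (p := fun r : ℝ => φ (radialPoint r t)
        = if |r| < 1 then φ (radialPoint r t) else 0) ?_ _
      filter_upwards [Ioo_mem_nhdsLT (neg_lt_self (zero_lt_one (α := ℝ)))] with r hr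
      rw [if_pos (abs_lt.2 hr)]
    rw [e]
    refine measurableSet_exists_tendsto fun q => Continuous.measurable ?_
    split_ifs with hq
    · refine hcont.comp_continuous ?_ fun t => radialPoint_mem_bidisc hq t
      unfold radialPoint; fun_prop
    · exact continuous_const
  have hslice : ∀ u : ℝ, ∀ᵐ s : ℝ, (s, u + s) ∈ S := by
    intro u
    set g : ℂ → ℂ := fun z => φ (z, z * Complex.exp (u * Complex.I)) with hg
    have hmem : ∀ z ∈ Metric.ball (0 : ℂ) 1,
        ((z, z * Complex.exp (u * Complex.I)) : ℂ × ℂ) ∈ bidisc := by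
      intro z hz
      have hz' : ‖z‖ < 1 := by simpa using hz
      constructor <;> simpa [Complex.norm_exp_ofReal_mul_I]
    have hgd : DifferentiableOn ℂ g (Metric.ball 0 1) :=
      hφ.1.differentiableOn.comp
        (f := fun z : ℂ => ((z, z * Complex.exp (u * Complex.I)) : ℂ × ℂ))
        (Differentiable.differentiableOn (by fun_prop)) hmem
    filter_upwards [ae_exists_radial_limit hgd fun z hz => hφ.2 _ (hmem z hz)] with s hs
    obtain ⟨ζ, hζ⟩ := hs
    refine ⟨ζ, hζ.congr fun r => ?_⟩
    simp only [hg, radialPoint, mul_assoc, ← Complex.exp_add]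
    congr 5
    push_cast; ring
  -- The shear (u, s) ↦ (s, u + s) preserves area and straightens the slices of constant angle
  -- difference, so Fubini turns the slicewise statement into one on the plane.
  have hmp := measurePreserving_prod_add_swap_right (volume : Measure ℝ) (volume : Measure ℝ)
  have hprod : ∀ᵐ z ∂((volume : Measure ℝ).prod (volume : Measure ℝ)), (z.2, z.1 + z.2) ∈ S := by
    have := (Measure.measure_prod_null (μ := (volume : Measure ℝ)) (ν := (volume : Measure ℝ))
      (hmp.measurable hSm.compl)).2 (Eventually.of_forall fun u => hslice u)
    exact this
  rw [ae_iff, Measure.volume_eq_prod]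
  rw [ae_iff] at hprod
  exact (hmp.measure_preimage hSm.compl.nullMeasurableSet).symm.trans hprod

/-! ### Parseval, Abel means and circle means -/

theorem integral_exp_int_mul_I {k : ℤ} :
    ∫ t in (0 : ℝ)..2 * Real.pi, Complex.exp (k * (t * Complex.I))
      = if k = 0 then 2 * Real.pi else 0 := by
  split_ifs with hk
  · simp [hk]
  · have hc : (k * Complex.I : ℂ) ≠ 0 := mul_ne_zero (by exact_mod_cast hk) Complex.I_ne_zero
    have e : (fun t : ℝ => Complex.exp (k * (t * Complex.I)))
        = fun t : ℝ => Complex.exp ((k * Complex.I) * t) := by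
      funext t; congr 1; ring
    rw [e, integral_exp_mul_complex hc]
    have : (k * Complex.I * (2 * Real.pi : ℝ) : ℂ) = k * (2 * Real.pi * Complex.I) := by
      push_cast; ring
    rw [this, Complex.exp_int_mul_two_pi_mul_I]
    simp

theorem summable_norm_sq {H : Type*} [NormedAddCommGroup H] {b : ℕ → H}
    (hb : Summable fun n => ‖b n‖) : Summable fun n => ‖b n‖ ^ 2 := by
  have h := (hb.mul_of_nonneg hb (fun _ => norm_nonneg _) fun _ => norm_nonneg _).comp_injective
    (i := fun n : ℕ => (n, n)) fun m n h => congrArg Prod.fst h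
  simpa only [pow_two, Function.comp_def] using h

section Parseval

variable {H : Type*} [NormedAddCommGroup H] [InnerProductSpace ℂ H] [CompleteSpace H]

/-- **Parseval's identity** for absolutely convergent Fourier series with values in a Hilbert
space. -/
theorem integral_norm_sq_tsum_exp {b : ℕ → H} (hb : Summable fun n => ‖b n‖) :
    ∫ t in (0 : ℝ)..2 * Real.pi, ‖∑' n : ℕ, Complex.exp (n * (t * Complex.I)) • b n‖ ^ 2
      = 2 * Real.pi * ∑' n, ‖b n‖ ^ 2 := by
  have hn : ∀ (t : ℝ) (n : ℕ), ‖Complex.exp (n * (t * Complex.I)) • b n‖ = ‖b n‖ := by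
    intro t n
    have : (n * (t * Complex.I) : ℂ) = ((n * t : ℝ) : ℂ) * Complex.I := by push_cast; ring
    rw [norm_smul, this, Complex.norm_exp_ofReal_mul_I, one_mul]
  have hs : ∀ t : ℝ, Summable fun n : ℕ => Complex.exp (n * (t * Complex.I)) • b n := fun t =>
    Summable.of_norm (by simpa only [hn] using hb)
  -- The squared norm is expanded into an absolutely convergent double series; after termwise
  -- integration only the diagonal survives.
  set F : ℕ × ℕ → ℝ → ℂ := fun p t =>
    Complex.exp (((p.2 : ℤ) - (p.1 : ℤ) : ℤ) * (t * Complex.I)) * inner ℂ (b p.1) (b p.2) with hF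
  have hprod : Summable fun p : ℕ × ℕ => ‖b p.1‖ * ‖b p.2‖ :=
    hb.mul_of_nonneg hb (fun _ => norm_nonneg _) fun _ => norm_nonneg _
  have hFn : ∀ p t, ‖F p t‖ ≤ ‖b p.1‖ * ‖b p.2‖ := by
    intro p t
    have : ((((p.2 : ℤ) - (p.1 : ℤ) : ℤ) : ℂ) * (t * Complex.I))
        = ((((p.2 : ℤ) - (p.1 : ℤ) : ℤ) * t : ℝ) : ℂ) * Complex.I := by push_cast; ring
    rw [hF, norm_mul, this, Complex.norm_exp_ofReal_mul_I, one_mul]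
    exact norm_inner_le_norm _ _
  have hpt : ∀ t : ℝ, HasSum (fun p => F p t)
      ((‖∑' n : ℕ, Complex.exp (n * (t * Complex.I)) • b n‖ ^ 2 : ℝ) : ℂ) := by
    intro t
    have hsum : Summable fun p => F p t := Summable.of_norm_bounded hprod fun p => hFn p t
    have e : ∑' p, F p t = ((‖∑' n : ℕ, Complex.exp (n * (t * Complex.I)) • b n‖ ^ 2 : ℝ) : ℂ) := by
      set x : ℕ → H := fun n => Complex.exp (n * (t * Complex.I)) • b n with hx
      have hF' : ∀ m n, F (m, n) t = inner ℂ (x m) (x n) := by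
        intro m n
        simp only [hF, hx]
        rw [inner_smul_left, inner_smul_right, ← Complex.exp_conj, ← mul_assoc (Complex.exp _),
          ← Complex.exp_add]
        congr 2
        simp
        ring
      have h1 : ∀ m, ∑' n, F (m, n) t = inner ℂ (x m) (∑' n, x n) := fun m => by
        simp only [hF']
        exact ((innerSL ℂ (x m)).hasSum (hs t).hasSum).tsum_eq
      rw [hsum.tsum_prod]
      simp only [h1]
      have h2 : HasSum (fun m => inner ℂ (x m) (∑' n, x n))
          (inner ℂ (∑' n, x n) (∑' n, x n)) := by
        have := Complex.hasSum_conj'.2 ((innerSL ℂ (∑' n, x n)).hasSum (hs t).hasSum)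
        simpa only [innerSL_apply_apply, inner_conj_symm] using this
      rw [h2.tsum_eq, inner_self_eq_norm_sq_to_K]
      simp
    rw [← e]; exact hsum.hasSum
  have hFc : ∀ p, Continuous (F p) := fun p => by simp only [hF]; fun_prop
  have hint := intervalIntegral.hasSum_integral_of_dominated_convergence
    (μ := volume) (a := 0) (b := 2 * Real.pi)
    (F := F) (fun (p : ℕ × ℕ) (_ : ℝ) => ‖b p.1‖ * ‖b p.2‖)
    (fun p => (hFc p).aestronglyMeasurable)
    (fun p => Eventually.of_forall fun t _ => hFn p t)
    (Eventually.of_forall fun t _ => hprod) intervalIntegrable_const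
    (Eventually.of_forall fun t _ => hpt t)
  rw [intervalIntegral.integral_ofReal] at hint
  have hval : ∀ p : ℕ × ℕ, ∫ t in (0 : ℝ)..2 * Real.pi, F p t
      = if p.1 = p.2 then ((2 * Real.pi * ‖b p.1‖ ^ 2 : ℝ) : ℂ) else 0 := by
    rintro ⟨m, n⟩
    simp only [hF]
    rw [intervalIntegral.integral_mul_const, integral_exp_int_mul_I]
    by_cases h : m = n
    · subst h
      rw [if_pos (by simp), if_pos rfl, inner_self_eq_norm_sq_to_K]
      simp
    · rw [if_neg (by omega), if_neg h, Complex.ofReal_zero, zero_mul]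
  simp only [hval] at hint
  have hdiag : HasSum (fun n : ℕ => ((2 * Real.pi * ‖b n‖ ^ 2 : ℝ) : ℂ))
      ((∫ t in (0 : ℝ)..2 * Real.pi,
        ‖∑' n : ℕ, Complex.exp (n * (t * Complex.I)) • b n‖ ^ 2 : ℝ) : ℂ) := by
    have hinj : Function.Injective fun n : ℕ => (n, n) := fun m n h => (Prod.mk.inj h).1
    have h3 := (hinj.hasSum_iff (f := fun p : ℕ × ℕ =>
      if p.1 = p.2 then ((2 * Real.pi * ‖b p.1‖ ^ 2 : ℝ) : ℂ) else 0) ?_).2 hint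
    · simpa [Function.comp_def] using h3
    · rintro ⟨m, n⟩ hmn
      exact if_neg fun h => hmn ⟨m, Prod.ext rfl h⟩
  rw [← tsum_mul_left]
  have hre := Complex.hasSum_re hdiag
  simp only [Complex.ofReal_re] at hre
  exact hre.tsum_eq.symm

end Parseval

/-- Abelian theorem: the Abel means of a null sequence tend to zero. -/
theorem tendsto_abel_mean_zero {c : ℕ → ℝ} (h0 : ∀ n, 0 ≤ c n) (hc : Tendsto c atTop (𝓝 0)) :
    Tendsto (fun q : ℝ => (1 - q) * ∑' n, q ^ n * c n) (𝓝[<] 1) (𝓝 0) := by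
  have hbdd : ∃ B, ∀ n, c n ≤ B := by
    obtain ⟨B, hB⟩ := hc.bddAbove_range
    exact ⟨B, fun n => hB ⟨n, rfl⟩⟩
  obtain ⟨B, hB⟩ := hbdd
  rw [Metric.tendsto_nhds]
  intro ε hε
  obtain ⟨N, hN⟩ := eventually_atTop.1 (hc.eventually_lt_const (half_pos hε))
  set A := ∑ n ∈ Finset.range N, c n
  have h1 : Tendsto (fun q : ℝ => (1 - q) * A + ε / 2) (𝓝[<] 1) (𝓝 (ε / 2)) := by
    have : Tendsto (fun q : ℝ => (1 - q) * A + ε / 2) (𝓝 1) (𝓝 ((1 - 1) * A + ε / 2)) :=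
      Continuous.tendsto (by fun_prop) _
    rw [sub_self, zero_mul, zero_add] at this
    exact this.mono_left nhdsWithin_le_nhds
  filter_upwards [h1.eventually_lt_const (half_lt_self hε),
    Ioo_mem_nhdsLT (zero_lt_one (α := ℝ))] with q hq hq01
  have hgeo := summable_geometric_of_lt_one hq01.1.le hq01.2
  have hs : Summable fun n => q ^ n * c n :=
    Summable.of_nonneg_of_le (fun n => mul_nonneg (pow_nonneg hq01.1.le n) (h0 n))
      (fun n => mul_le_mul_of_nonneg_left (hB n) (pow_nonneg hq01.1.le n)) (hgeo.mul_right B)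
  have hq1 : 0 < 1 - q := sub_pos.2 hq01.2
  have hnn : 0 ≤ ∑' n, q ^ n * c n :=
    tsum_nonneg fun n => mul_nonneg (pow_nonneg hq01.1.le n) (h0 n)
  rw [Real.dist_eq, sub_zero, abs_of_nonneg (mul_nonneg hq1.le hnn)]
  refine lt_of_le_of_lt ?_ hq
  have hfin : ∑ n ∈ Finset.range N, q ^ n * c n ≤ A :=
    Finset.sum_le_sum fun n _ =>
      mul_le_of_le_one_left (h0 n) (pow_le_one₀ hq01.1.le hq01.2.le)
  have htail : ∑' n, q ^ (n + N) * c (n + N) ≤ (1 - q)⁻¹ * (ε / 2) := by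
    rw [← tsum_geometric_of_lt_one hq01.1.le hq01.2, ← tsum_mul_right]
    refine Summable.tsum_le_tsum (fun n => ?_) ((summable_nat_add_iff N).2 hs)
      (hgeo.mul_right _)
    refine mul_le_mul ?_ (hN _ (by omega)).le (h0 _) (pow_nonneg hq01.1.le n)
    exact pow_le_pow_of_le_one hq01.1.le hq01.2.le (by omega)
  rw [← hs.sum_add_tsum_nat_add N, mul_add]
  refine add_le_add (mul_le_mul_of_nonneg_left hfin hq1.le) ?_
  calc (1 - q) * _ ≤ (1 - q) * ((1 - q)⁻¹ * (ε / 2)) := mul_le_mul_of_nonneg_left htail hq1.le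
    _ = ε / 2 := by field_simp

/-- The quadratic means of a holomorphic function on the disc over circles increase with the
radius. -/
theorem integral_norm_sq_circle_mono {g : ℂ → ℂ} (hg : DifferentiableOn ℂ g (Metric.ball 0 1))
    {r s : ℝ} (hr : 0 ≤ r) (hrs : r ≤ s) (hs : s < 1) :
    ∫ t in (0 : ℝ)..2 * Real.pi, ‖g (r * Complex.exp (t * Complex.I))‖ ^ 2
      ≤ ∫ t in (0 : ℝ)..2 * Real.pi, ‖g (s * Complex.exp (t * Complex.I))‖ ^ 2 := by
  obtain ⟨R, hsR, hR1⟩ := exists_between hs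
  have hR0 : 0 < R := (hr.trans hrs).trans_lt hsR
  lift R to NNReal using hR0.le
  -- The means are 2π Σ q²ⁿ|aₙ|² with aₙ independent of q, so they are compared term by term.
  have hp := (hg.mono (Metric.closedBall_subset_ball hR1)).hasFPowerSeriesOnBall
    (by exact_mod_cast hR0)
  set p := cauchyPowerSeries g 0 R
  have key : ∀ q : ℝ, 0 ≤ q → q < R →
      (Summable fun n => ‖((q : ℂ) ^ n * p.coeff n)‖) ∧
      ∫ t in (0 : ℝ)..2 * Real.pi, ‖g (q * Complex.exp (t * Complex.I))‖ ^ 2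
        = 2 * Real.pi * ∑' n, ‖((q : ℂ) ^ n * p.coeff n)‖ ^ 2 := by
    intro q hq0 hqR
    lift q to NNReal using hq0
    have hsum : Summable fun n => ‖(((q : ℝ) : ℂ) ^ n * p.coeff n)‖ := by
      have := p.summable_norm_mul_pow (r := q)
        (lt_of_lt_of_le (by exact_mod_cast hqR) hp.r_le)
      refine this.congr fun n => ?_
      rw [norm_mul, norm_pow, mul_comm, FormalMultilinearSeries.norm_apply_eq_norm_coef]
      simp
    refine ⟨hsum, ?_⟩
    rw [← integral_norm_sq_tsum_exp hsum]
    refine intervalIntegral.integral_congr fun t _ => ?_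
    congr 2
    have hz : ((q : ℝ) : ℂ) * Complex.exp (t * Complex.I) ∈ Metric.eball (0 : ℂ) R := by
      rw [Metric.eball_coe, mem_ball_zero_iff, norm_mul, Complex.norm_exp_ofReal_mul_I, mul_one,
        Complex.norm_real, Real.norm_eq_abs, abs_of_nonneg q.coe_nonneg]
      exact hqR
    have := (hp.hasSum hz).tsum_eq
    rw [zero_add] at this
    rw [← this]
    refine tsum_congr fun n => ?_
    rw [p.apply_eq_pow_smul_coeff, mul_pow, Complex.exp_nat_mul, smul_eq_mul, smul_eq_mul]
    ring
  obtain ⟨h1, e1⟩ := key r hr (hrs.trans_lt hsR)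
  obtain ⟨h2, e2⟩ := key s (hr.trans hrs) hsR
  rw [e1, e2]
  refine mul_le_mul_of_nonneg_left ?_ Real.two_pi_pos.le
  refine Summable.tsum_le_tsum (fun n => ?_) (summable_norm_sq h1) (summable_norm_sq h2)
  rw [norm_mul, norm_mul, norm_pow, norm_pow, Complex.norm_real, Complex.norm_real,
    Real.norm_eq_abs, Real.norm_eq_abs, abs_of_nonneg hr, abs_of_nonneg (hr.trans hrs)]
  gcongr

/-! ### Resolvents of contractions -/

section Resolvent

variable {H : Type*} [NormedAddCommGroup H] [InnerProductSpace ℂ H]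

/-- The Neumann series `∑ zⁿ Tⁿ y` of `(1 - z T)⁻¹ y`. -/
noncomputable def neumann (T : H →L[ℂ] H) (z : ℂ) (y : H) : H := ∑' n : ℕ, z ^ n • (T ^ n) y

theorem norm_pow_apply_le {T : H →L[ℂ] H} (hT : ‖T‖ ≤ 1) (n : ℕ) (y : H) : ‖(T ^ n) y‖ ≤ ‖y‖ := by
  induction n with
  | zero => simp
  | succ n ih =>
    rw [pow_succ', mul_apply_eq_comp]
    exact ((T.le_of_opNorm_le hT _).trans_eq (one_mul _)).trans ih

theorem summable_norm_neumann {T : H →L[ℂ] H} (hT : ‖T‖ ≤ 1) {z : ℂ} (hz : ‖z‖ < 1) (y : H) :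
    Summable fun n : ℕ => ‖z ^ n • (T ^ n) y‖ := by
  refine Summable.of_nonneg_of_le (fun _ => norm_nonneg _) (fun n => ?_)
    ((summable_geometric_of_lt_one (norm_nonneg z) hz).mul_right ‖y‖)
  rw [norm_smul, norm_pow]
  exact mul_le_mul_of_nonneg_left (norm_pow_apply_le hT n y) (by positivity)

variable [CompleteSpace H]

/-- Iterating the fixed-point equation leaves a remainder zⁿTⁿx, which tends to zero since T is a
contraction and |z| < 1. -/
theorem eq_neumann_of_eq {T : H →L[ℂ] H} (hT : ‖T‖ ≤ 1) {z : ℂ} (hz : ‖z‖ < 1) {x y : H}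
    (h : x = y + z • T x) : x = neumann T z y := by
  have hfin : ∀ n : ℕ, x = ∑ k ∈ Finset.range n, z ^ k • (T ^ k) y + z ^ n • (T ^ n) x := by
    intro n
    induction n with
    | zero => simp
    | succ n ih =>
      have e : z ^ n • (T ^ n) x = z ^ n • (T ^ n) y + z ^ (n + 1) • (T ^ (n + 1)) x := by
        conv_lhs => rw [h]
        rw [map_add, map_smul, smul_add, smul_smul, ← pow_succ, pow_succ T,
          mul_apply_eq_comp]
      rw [Finset.sum_range_succ, add_assoc, ← e]
      exact ih
  have h1 := (summable_norm_neumann hT hz y).of_norm.hasSum.tendsto_sum_nat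
  have h2 := (summable_norm_neumann hT hz x).of_norm.tendsto_atTop_zero
  have h3 := h1.add h2
  rw [add_zero] at h3
  exact tendsto_nhds_unique (tendsto_const_nhds.congr hfin) h3

theorem integral_norm_sq_neumann {T : H →L[ℂ] H} (hT : ‖T‖ ≤ 1) {r : ℝ} (h0 : 0 ≤ r) (h1 : r < 1)
    (y : H) :
    ∫ t in (0 : ℝ)..2 * Real.pi, ‖neumann T (r * Complex.exp (t * Complex.I)) y‖ ^ 2
      = 2 * Real.pi * ∑' n : ℕ, (r ^ 2) ^ n * ‖(T ^ n) y‖ ^ 2 := by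
  have hr : ‖(r : ℂ)‖ = r := by rw [Complex.norm_real, Real.norm_eq_abs, abs_of_nonneg h0]
  have h := integral_norm_sq_tsum_exp (summable_norm_neumann hT (hr.trans_lt h1) y)
  have e : ∀ n : ℕ, ‖(r : ℂ) ^ n • (T ^ n) y‖ ^ 2 = (r ^ 2) ^ n * ‖(T ^ n) y‖ ^ 2 := by
    intro n
    rw [norm_smul, norm_pow, hr, mul_pow, ← pow_mul, ← pow_mul, mul_comm n]
  simp only [e] at h
  rw [← h]
  refine intervalIntegral.integral_congr fun t _ => ?_
  simp only [neumann, smul_smul, mul_pow, ← Complex.exp_nat_mul, mul_comm]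

/-- The quadratic means of the resolvent of a `C_{0·}` contraction grow slower than
`(1 - r²)⁻¹`. -/
theorem IsC0.tendsto_integral_neumann {T : H →L[ℂ] H} (hT : IsC0 T) (y : H) :
    Tendsto (fun r : ℝ => (1 - r ^ 2) *
      ∫ t in (0 : ℝ)..2 * Real.pi, ‖neumann T (r * Complex.exp (t * Complex.I)) y‖ ^ 2)
      (𝓝[<] 1) (𝓝 0) := by
  have hc : Tendsto (fun n : ℕ => ‖(T ^ n) y‖ ^ 2) atTop (𝓝 0) := by
    simpa using (hT.2 y).norm.pow 2
  have hsq : Tendsto (fun r : ℝ => r ^ 2) (𝓝[<] 1) (𝓝[<] 1) := by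
    refine tendsto_nhdsWithin_iff.2 ⟨?_, ?_⟩
    · exact (Continuous.tendsto' (by fun_prop) _ _ (by norm_num)).mono_left nhdsWithin_le_nhds
    · filter_upwards [Ioo_mem_nhdsLT (zero_lt_one (α := ℝ))] with r hr
      exact pow_lt_one₀ hr.1.le hr.2 two_ne_zero
  have h := ((tendsto_abel_mean_zero (fun n => sq_nonneg ‖(T ^ n) y‖) hc).comp hsq).const_mul
    (2 * Real.pi)
  rw [mul_zero] at h
  refine h.congr' ?_
  filter_upwards [Ioo_mem_nhdsLT (zero_lt_one (α := ℝ))] with r hr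
  rw [integral_norm_sq_neumann hT.1 hr.1.le hr.2, Function.comp_apply]
  ring

end Resolvent

/-! ### Energy balance of the colligation -/

section Colligation

variable {H₁ H₂ : Type*}
    [NormedAddCommGroup H₁] [InnerProductSpace ℂ H₁] [CompleteSpace H₁]
    [NormedAddCommGroup H₂] [InnerProductSpace ℂ H₂] [CompleteSpace H₂]

/-- The energy balance of an isometric colligation with block triangular state operator. -/
theorem one_sub_norm_transfer_sq
    {V : WithLp 2 (ℂ × WithLp 2 (H₁ × H₂)) →L[ℂ] WithLp 2 (ℂ × WithLp 2 (H₁ × H₂))}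
    (hV : Isometry V) (hD₂₁ : block₂₁ (block₂₂ V) = 0)
    (hD₁ : ‖block₁₁ (block₂₂ V)‖ ≤ 1) (hD₃ : ‖block₂₂ (block₂₂ V)‖ ≤ 1)
    {z : ℂ × ℂ} (hz : z ∈ bidisc) :
    1 - ‖transfer V z‖ ^ 2
      = (1 - ‖z.1‖ ^ 2) * ‖neumann (block₁₁ (block₂₂ V)) z.1 (fst (block₂₁ V 1) +
          z.2 • block₁₂ (block₂₂ V) (neumann (block₂₂ (block₂₂ V)) z.2 (snd (block₂₁ V 1))))‖ ^ 2
        + (1 - ‖z.2‖ ^ 2) * ‖neumann (block₂₂ (block₂₂ V)) z.2 (snd (block₂₁ V 1))‖ ^ 2 := by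
  set D := block₂₂ V with hD
  set c := block₂₁ V 1 with hc
  set h := (Ring.inverse (1 - diagOp z * D) :
      WithLp 2 (H₁ × H₂) →L[ℂ] WithLp 2 (H₁ × H₂)) (diagOp z c) with hh
  have hh' : h = diagOp z (c + D h) := by
    have h1 := Ring.mul_inverse_cancel _ (isUnit_one_sub_diagOp_mul V hV hz)
    have h2 : (1 - diagOp z * D : WithLp 2 (H₁ × H₂) →L[ℂ] WithLp 2 (H₁ × H₂)) h = diagOp z c := by
      rw [hh, ← mul_apply_eq_comp, h1, one_apply_eq_self]
    rw [sub_apply, one_apply_eq_self,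
      mul_apply_eq_comp, sub_eq_iff_eq_add] at h2
    rw [map_add]
    exact h2
  set f := c + D h with hf
  have h1 : h.fst = z.1 • f.fst := by
    conv_lhs => rw [hh']
    simp [diagOp, inl, inr, fst, snd]
  have h2 : h.snd = z.2 • f.snd := by
    conv_lhs => rw [hh']
    simp [diagOp, inl, inr, fst, snd]
  have hdec : h = inl h.fst + inr h.snd := by
    refine WithLp.ofLp_injective 2 (Prod.ext ?_ ?_) <;> simp [inl, inr]
  -- Triangularity enters here: the second state equation decouples from the first.
  have hDs : (D h).snd = block₂₂ D h.snd := by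
    have := congrArg (fun T : H₁ →L[ℂ] H₂ => T h.fst) hD₂₁
    have e : (D h).snd = block₂₁ D h.fst + block₂₂ D h.snd := by
      conv_lhs => rw [hdec, map_add]
      rfl
    rw [e]
    rw [show block₂₁ D h.fst = 0 from this, zero_add]
  have hDf : (D h).fst = block₁₁ D h.fst + block₁₂ D h.snd := by
    conv_lhs => rw [hdec, map_add]
    rfl
  have f2 : f.snd = neumann (block₂₂ D) z.2 (snd c) := by
    refine eq_neumann_of_eq hD₃ hz.2 ?_
    rw [← map_smul, ← h2, ← hDs]
    rfl
  have f1 : f.fst = neumann (block₁₁ D) z.1 (fst c + z.2 • block₁₂ D f.snd) := by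
    refine eq_neumann_of_eq hD₁ hz.1 ?_
    rw [← map_smul, ← map_smul, ← h1, ← h2, add_assoc, add_comm (block₁₂ D _), ← hDf]
    rfl
  rw [← f2, ← f1]
  have hVx : V (inl 1 + inr h) = inl (transfer V z) + inr f := by
    rw [map_add]
    refine WithLp.ofLp_injective 2 (Prod.ext ?_ ?_)
    · simp [inl, inr, transfer, ← hc]
      rfl
    · simp [inl, inr, hf, hc, hD]
      rfl
  have hn := (AddMonoidHomClass.isometry_iff_norm V).1 hV (inl 1 + inr h)
  rw [hVx] at hn
  have hn2 : ‖inl (transfer V z) + inr f‖ ^ 2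
      = ‖(inl 1 + inr h : WithLp 2 (ℂ × WithLp 2 (H₁ × H₂)))‖ ^ 2 := by rw [hn]
  have hsq : ∀ (x : ℂ) (y : WithLp 2 (H₁ × H₂)), ‖inl x + inr y‖ ^ 2 = ‖x‖ ^ 2 + ‖y‖ ^ 2 :=
    fun x y => by rw [WithLp.prod_norm_sq_eq_of_L2]; simp [inl, inr]
  rw [hsq, hsq, WithLp.prod_norm_sq_eq_of_L2 h, WithLp.prod_norm_sq_eq_of_L2 f, h1, h2, norm_smul,
    norm_smul, norm_one] at hn2
  linarith

end Colligation

/-! ### The defect and its monotonicity in the radii -/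

/-- The defect `1 - |φ|²` of a Schur function at the point of polyradius `(r, s)` and angles
`(a, b)`. -/
noncomputable def defect (φ : ℂ × ℂ → ℂ) (r s a b : ℝ) : ℝ :=
  1 - ‖φ (r * Complex.exp (a * Complex.I), s * Complex.exp (b * Complex.I))‖ ^ 2

/-- The integral of the defect over the torus of polyradius `(r, s)`. -/
noncomputable def totalDefect (φ : ℂ × ℂ → ℂ) (r s : ℝ) : ℝ :=
  ∫ b in (0 : ℝ)..2 * Real.pi, ∫ a in (0 : ℝ)..2 * Real.pi, defect φ r s a b

variable {φ : ℂ × ℂ → ℂ}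

theorem continuous_defect (hφ : IsSchur φ) {r s : ℝ} (hr : |r| < 1) (hs : |s| < 1) :
    Continuous fun p : ℝ × ℝ => defect φ r s p.1 p.2 := by
  have : Continuous fun p : ℝ × ℝ =>
      φ (r * Complex.exp (p.1 * Complex.I), s * Complex.exp (p.2 * Complex.I)) :=
    hφ.1.continuousOn.comp_continuous (by fun_prop) fun p => torus_mem_bidisc hr hs _ _
  exact continuous_const.sub (this.norm.pow 2)

theorem continuous_integral_defect_left (hφ : IsSchur φ) {r s : ℝ} (hr : |r| < 1) (hs : |s| < 1) :
    Continuous fun b : ℝ => ∫ a in (0 : ℝ)..2 * Real.pi, defect φ r s a b := by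
  have h0 := (continuous_defect hφ hr hs).comp (continuous_swap (X := ℝ) (Y := ℝ))
  have h : Continuous (Function.uncurry fun b a : ℝ => defect φ r s a b) := h0
  exact intervalIntegral.continuous_parametric_intervalIntegral_of_continuous' h _ _

theorem continuous_integral_defect_right (hφ : IsSchur φ) {r s : ℝ} (hr : |r| < 1)
    (hs : |s| < 1) : Continuous fun a : ℝ => ∫ b in (0 : ℝ)..2 * Real.pi, defect φ r s a b := by
  have h : Continuous (Function.uncurry fun a b : ℝ => defect φ r s a b) :=
    continuous_defect hφ hr hs
  exact intervalIntegral.continuous_parametric_intervalIntegral_of_continuous' h _ _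

theorem defect_mem_Icc (hφ : IsSchur φ) {r s : ℝ} (hr : |r| < 1) (hs : |s| < 1) (a b : ℝ) :
    defect φ r s a b ∈ Icc (0 : ℝ) 1 := by
  have h := hφ.2 _ (torus_mem_bidisc hr hs a b)
  have h2 := pow_le_one₀ (n := 2) (norm_nonneg _) h
  exact ⟨sub_nonneg.2 h2, sub_le_self _ (by positivity)⟩

theorem totalDefect_swap (hφ : IsSchur φ) {r s : ℝ} (hr : |r| < 1) (hs : |s| < 1) :
    totalDefect φ r s
      = ∫ a in (0 : ℝ)..2 * Real.pi, ∫ b in (0 : ℝ)..2 * Real.pi, defect φ r s a b := by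
  refine intervalIntegral_intervalIntegral_swap
    (IntegrableOn.mono_set (t := uIcc 0 (2 * Real.pi) ×ˢ uIcc 0 (2 * Real.pi)) ?_
      (prod_mono uIoc_subset_uIcc uIoc_subset_uIcc))
  have h := (continuous_defect hφ hr hs).comp (continuous_swap (X := ℝ) (Y := ℝ))
  exact h.continuousOn.integrableOn_compact
    (isCompact_uIcc.prod isCompact_uIcc)

/-- In each variable the quadratic mean of a holomorphic function grows with the radius, so its
defect shrinks. -/
theorem integral_defect_anti_left (hφ : IsSchur φ) {r r' s : ℝ} (h0 : 0 ≤ r) (hrr : r ≤ r')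
    (h1 : r' < 1) (hs : |s| < 1) (b : ℝ) :
    ∫ a in (0 : ℝ)..2 * Real.pi, defect φ r' s a b
      ≤ ∫ a in (0 : ℝ)..2 * Real.pi, defect φ r s a b := by
  have hr : |r| < 1 := by rw [abs_of_nonneg h0]; exact hrr.trans_lt h1
  have hr' : |r'| < 1 := by rw [abs_of_nonneg (h0.trans hrr)]; exact h1
  have hc : ∀ q : ℝ, |q| < 1 → Continuous fun a : ℝ =>
      ‖φ (q * Complex.exp (a * Complex.I), s * Complex.exp (b * Complex.I))‖ ^ 2 := fun q hq =>
    (hφ.1.continuousOn.comp_continuous (by fun_prop) fun p =>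
      torus_mem_bidisc hq hs _ _).norm.pow 2
  simp only [defect]
  rw [intervalIntegral.integral_sub intervalIntegrable_const ((hc _ hr').intervalIntegrable _ _),
    intervalIntegral.integral_sub intervalIntegrable_const ((hc _ hr).intervalIntegrable _ _)]
  refine sub_le_sub_left ?_ _
  refine integral_norm_sq_circle_mono
    (g := fun z => φ (z, s * Complex.exp (b * Complex.I))) ?_ h0 hrr h1
  refine hφ.1.differentiableOn.comp
    (f := fun z : ℂ => ((z, s * Complex.exp (b * Complex.I)) : ℂ × ℂ))
    (Differentiable.differentiableOn (by fun_prop)) fun z hz => ⟨by simpa using hz, ?_⟩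
  simpa [Complex.norm_exp_ofReal_mul_I] using hs

theorem integral_defect_anti_right (hφ : IsSchur φ) {r s s' : ℝ} (hr : |r| < 1) (h0 : 0 ≤ s)
    (hss : s ≤ s') (h1 : s' < 1) (a : ℝ) :
    ∫ b in (0 : ℝ)..2 * Real.pi, defect φ r s' a b
      ≤ ∫ b in (0 : ℝ)..2 * Real.pi, defect φ r s a b := by
  have hsw : IsSchur fun z : ℂ × ℂ => φ z.swap := by
    refine ⟨?_, fun z hz => hφ.2 _ ⟨hz.2, hz.1⟩⟩
    have hmaps : MapsTo (fun z : ℂ × ℂ => (z.2, z.1)) bidisc bidisc := fun z hz => ⟨hz.2, hz.1⟩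
    exact hφ.1.comp (analyticOnNhd_snd.prod analyticOnNhd_fst) hmaps
  exact integral_defect_anti_left hsw h0 hss h1 hr a

theorem totalDefect_anti (hφ : IsSchur φ) {r r' s s' : ℝ} (hr : 0 ≤ r) (hrr : r ≤ r')
    (hr' : r' < 1) (hs : 0 ≤ s) (hss : s ≤ s') (hs' : s' < 1) :
    totalDefect φ r' s' ≤ totalDefect φ r s := by
  have ar : |r| < 1 := by rw [abs_of_nonneg hr]; exact hrr.trans_lt hr'
  have ar' : |r'| < 1 := by rw [abs_of_nonneg (hr.trans hrr)]; exact hr'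
  have as : |s| < 1 := by rw [abs_of_nonneg hs]; exact hss.trans_lt hs'
  have as' : |s'| < 1 := by rw [abs_of_nonneg (hs.trans hss)]; exact hs'
  calc totalDefect φ r' s' ≤ totalDefect φ r s' :=
        intervalIntegral.integral_mono Real.two_pi_pos.le
          ((continuous_integral_defect_left hφ ar' as').intervalIntegrable _ _)
          ((continuous_integral_defect_left hφ ar as').intervalIntegrable _ _)
          fun b => integral_defect_anti_left hφ hr hrr hr' as' b
    _ ≤ totalDefect φ r s := by
        rw [totalDefect_swap hφ ar as', totalDefect_swap hφ ar as]
        exact intervalIntegral.integral_mono Real.two_pi_pos.le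
          ((continuous_integral_defect_right hφ ar as').intervalIntegrable _ _)
          ((continuous_integral_defect_right hφ ar as).intervalIntegrable _ _)
          fun a => integral_defect_anti_right hφ ar hs hss hs' a

/-! ### From small defect to unimodular boundary values -/

/-- A Schur function whose total defect becomes arbitrarily small is inner. -/
theorem isInner_of_totalDefect_small (hφ : IsSchur φ)
    (h : ∀ ε > 0, ∃ r ∈ Ioo (0 : ℝ) 1, ∃ s ∈ Ioo (0 : ℝ) 1, totalDefect φ r s < ε) :
    IsInner φ := by
  refine ⟨hφ, ?_⟩
  set I := Ioc 0 (2 * Real.pi)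
  set μ : Measure (ℝ × ℝ) := volume.restrict (I ×ˢ I) with hμ
  have hdef : ∀ r : ℝ, |r| < 1 → ∫ t, defect φ r r t.1 t.2 ∂μ = totalDefect φ r r := by
    intro r hr
    have hcomp : IntegrableOn (fun t : ℝ × ℝ => defect φ r r t.1 t.2) (I ×ˢ I)
        (volume.prod volume) := by
      refine IntegrableOn.mono_set (t := Icc 0 (2 * Real.pi) ×ˢ Icc 0 (2 * Real.pi)) ?_
        (prod_mono Ioc_subset_Icc_self Ioc_subset_Icc_self)
      exact (continuous_defect hφ hr hr).continuousOn.integrableOn_compact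
        (isCompact_Icc.prod isCompact_Icc)
    rw [totalDefect_swap hφ hr hr, hμ, Measure.volume_eq_prod, setIntegral_prod _ hcomp,
      intervalIntegral.integral_of_le Real.two_pi_pos.le]
    simp only [intervalIntegral.integral_of_le Real.two_pi_pos.le, I]
  have hlim0 : Tendsto (fun r : ℝ => totalDefect φ r r) (𝓝[<] 1) (𝓝 0) := by
    rw [Metric.tendsto_nhds]
    intro ε hε
    obtain ⟨r, hr, s, hs, hrs⟩ := h ε hε
    filter_upwards [Ioo_mem_nhdsLT (max_lt hr.2 hs.2)] with q hq
    have hq1 := ((le_max_left _ _).trans_lt hq.1).le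
    have hq2 := ((le_max_right _ _).trans_lt hq.1).le
    have hqa : |q| < 1 := by rw [abs_of_pos (hr.1.trans_le hq1)]; exact hq.2
    have hnn : 0 ≤ totalDefect φ q q :=
      intervalIntegral.integral_nonneg Real.two_pi_pos.le fun b _ =>
        intervalIntegral.integral_nonneg Real.two_pi_pos.le fun a _ =>
          (defect_mem_Icc hφ hqa hqa a b).1
    rw [Real.dist_eq, sub_zero, abs_of_nonneg hnn]
    exact (totalDefect_anti hφ hr.1.le hq1 hq.2 hs.1.le hq2 hq.2).trans_lt hrs
  have hev : ∀ᶠ r : ℝ in 𝓝[<] 1, |r| < 1 := by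
    filter_upwards [Ioo_mem_nhdsLT (neg_lt_self (zero_lt_one (α := ℝ)))] with r hr
    exact abs_lt.2 hr
  have hae := ae_restrict_of_ae (s := I ×ˢ I) (ae_exists_radial_limit_of_isSchur hφ)
  rw [← hμ] at hae
  have hex : ∃ ζ : ℝ × ℝ → ℂ, ∀ᵐ t ∂μ,
      Tendsto (fun r : ℝ => φ (radialPoint r t)) (𝓝[<] 1) (𝓝 (ζ t)) := by
    have hch : ∀ t, ∃ z : ℂ, (∃ ζ : ℂ, Tendsto (fun r : ℝ => φ (radialPoint r t)) (𝓝[<] 1) (𝓝 ζ)) →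
        Tendsto (fun r : ℝ => φ (radialPoint r t)) (𝓝[<] 1) (𝓝 z) := fun t => by
      by_cases ht : ∃ ζ : ℂ, Tendsto (fun r : ℝ => φ (radialPoint r t)) (𝓝[<] 1) (𝓝 ζ)
      · exact ht.imp fun z hz _ => hz
      · exact ⟨0, fun h => absurd h ht⟩
    choose ζ hζ using hch
    exact ⟨ζ, hae.mono hζ⟩
  obtain ⟨ζ, hζ⟩ := hex
  have hfin : IsFiniteMeasure μ := by
    rw [hμ, Measure.volume_eq_prod, ← Measure.prod_restrict]
    infer_instance
  have hdlim : ∀ᵐ t ∂μ, Tendsto (fun r : ℝ => defect φ r r t.1 t.2) (𝓝[<] 1)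
      (𝓝 (1 - ‖ζ t‖ ^ 2)) :=
    hζ.mono fun t ht => tendsto_const_nhds.sub (ht.norm.pow 2)
  have hmeas : ∀ᶠ r : ℝ in 𝓝[<] 1,
      AEStronglyMeasurable (fun t : ℝ × ℝ => defect φ r r t.1 t.2) μ :=
    hev.mono fun r hr => (continuous_defect hφ hr hr).aestronglyMeasurable
  have hbound : ∀ᶠ r : ℝ in 𝓝[<] 1, ∀ᵐ t ∂μ, ‖defect φ r r t.1 t.2‖ ≤ 1 :=
    hev.mono fun r hr => Eventually.of_forall fun t => by
      have := defect_mem_Icc hφ hr hr t.1 t.2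
      rw [Real.norm_eq_abs, abs_of_nonneg this.1]
      exact this.2
  have hint := tendsto_integral_filter_of_dominated_convergence (fun _ => (1 : ℝ)) hmeas hbound
    (integrable_const _) hdlim
  have hzero : ∫ t, (1 - ‖ζ t‖ ^ 2) ∂μ = 0 :=
    tendsto_nhds_unique (hint.congr' (hev.mono hdef)) hlim0
  have hnn : ∀ᵐ t ∂μ, 1 - ‖ζ t‖ ^ 2 ∈ Icc (0 : ℝ) 1 := hdlim.mono fun t ht =>
    isClosed_Icc.mem_of_tendsto ht (hev.mono fun r hr => defect_mem_Icc hφ hr hr t.1 t.2)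
  have hint' : Integrable (fun t => 1 - ‖ζ t‖ ^ 2) μ := by
    -- The chosen ζ carries no measurability; the boundary defect inherits it as an almost
    -- everywhere limit along a sequence of radii.
    obtain ⟨u, hu, hum⟩ := exists_seq_forall_of_frequently hmeas.frequently
    refine Integrable.of_bound (aestronglyMeasurable_of_tendsto_ae atTop hum
      (hdlim.mono fun t ht => ht.comp hu)) 1 (hnn.mono fun t ht => ?_)
    rw [Real.norm_eq_abs, abs_of_nonneg ht.1]
    exact ht.2
  have hz := (integral_eq_zero_iff_of_nonneg_ae (hnn.mono fun t ht => ht.1) hint').1 hzero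
  filter_upwards [hζ, hz] with t ht htz
  refine ⟨ζ t, ht, ?_⟩
  have h1 : ‖ζ t‖ ^ 2 = 1 := by
    have : 1 - ‖ζ t‖ ^ 2 = 0 := htz
    linarith
  exact (pow_eq_one_iff_of_nonneg (norm_nonneg _) two_ne_zero).1 h1

/-! ### The two successive radial limits -/

section Realization

variable {H₁ H₂ : Type*}
    [NormedAddCommGroup H₁] [InnerProductSpace ℂ H₁] [CompleteSpace H₁]
    [NormedAddCommGroup H₂] [InnerProductSpace ℂ H₂] [CompleteSpace H₂]
    {V : WithLp 2 (ℂ × WithLp 2 (H₁ × H₂)) →L[ℂ] WithLp 2 (ℂ × WithLp 2 (H₁ × H₂))}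

/-- For a transfer function with `D₁` of class `C_{0·}`, the mean of the defect over the first
angle converges to the energy of the second state space as the first radius tends to one. -/
theorem tendsto_integral_defect (hφ : IsSchur φ) (hV : Isometry V)
    (hτ : ∀ z ∈ bidisc, φ z = transfer V z) (hD₂₁ : block₂₁ (block₂₂ V) = 0)
    (hD₁ : IsC0 (block₁₁ (block₂₂ V))) (hD₃ : IsC0 (block₂₂ (block₂₂ V)))
    {s : ℝ} (h0 : 0 ≤ s) (h1 : s < 1) (b : ℝ) :
    Tendsto (fun r : ℝ => ∫ a in (0 : ℝ)..2 * Real.pi, defect φ r s a b) (𝓝[<] 1)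
      (𝓝 (2 * Real.pi * ((1 - s ^ 2) * ‖neumann (block₂₂ (block₂₂ V))
        (s * Complex.exp (b * Complex.I)) (snd (block₂₁ V 1))‖ ^ 2))) := by
  set w : ℂ := s * Complex.exp (b * Complex.I) with hw
  set f₂ := neumann (block₂₂ (block₂₂ V)) w (snd (block₂₁ V 1)) with hf₂
  set y := fst (block₂₁ V 1) + w • block₁₂ (block₂₂ V) f₂ with hy
  have hs : |s| < 1 := by rwa [abs_of_nonneg h0]
  have hnorm : ∀ {q : ℝ}, 0 ≤ q → ∀ a : ℝ, ‖(q * Complex.exp (a * Complex.I) : ℂ)‖ = q := by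
    intro q hq a
    rw [norm_mul, Complex.norm_exp_ofReal_mul_I, mul_one, Complex.norm_real, Real.norm_eq_abs,
      abs_of_nonneg hq]
  have h := (hD₁.tendsto_integral_neumann y).add_const
    (2 * Real.pi * ((1 - s ^ 2) * ‖f₂‖ ^ 2))
  rw [zero_add] at h
  refine h.congr' ?_
  filter_upwards [Ioo_mem_nhdsLT (zero_lt_one (α := ℝ))] with r hr
  have har : |r| < 1 := by rw [abs_of_pos hr.1]; exact hr.2
  have hd : ∀ a : ℝ, (1 - r ^ 2) *
      ‖neumann (block₁₁ (block₂₂ V)) (r * Complex.exp (a * Complex.I)) y‖ ^ 2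
      = defect φ r s a b - (1 - s ^ 2) * ‖f₂‖ ^ 2 := by
    intro a
    have hz := torus_mem_bidisc har hs a b
    have := one_sub_norm_transfer_sq hV hD₂₁ hD₁.1 hD₃.1 hz
    rw [defect, hτ _ hz, this, hnorm hr.1.le, hnorm h0, add_sub_cancel_right]
  rw [← intervalIntegral.integral_const_mul]
  simp only [hd]
  have hc' := (continuous_defect hφ har hs).comp (Continuous.prodMk_left (Y := ℝ) b)
  have hc : Continuous fun a : ℝ => defect φ r s a b := hc'
  rw [intervalIntegral.integral_sub (hc.intervalIntegrable _ _) intervalIntegrable_const,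
    intervalIntegral.integral_const, smul_eq_mul, sub_zero, sub_add_cancel]

/-- The order matters: s is fixed first, making the f₂ energy small, and r is then taken close to 1
depending on s, since the vector driving f₁ depends on s. -/
theorem exists_totalDefect_lt (hφ : IsSchur φ) (hV : Isometry V)
    (hτ : ∀ z ∈ bidisc, φ z = transfer V z) (hD₂₁ : block₂₁ (block₂₂ V) = 0)
    (hD₁ : IsC0 (block₁₁ (block₂₂ V))) (hD₃ : IsC0 (block₂₂ (block₂₂ V))) {ε : ℝ} (hε : 0 < ε) :
    ∃ r ∈ Ioo (0 : ℝ) 1, ∃ s ∈ Ioo (0 : ℝ) 1, totalDefect φ r s < ε := by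
  have h2 := (hD₃.tendsto_integral_neumann (snd (block₂₁ V 1))).const_mul (2 * Real.pi)
  rw [mul_zero] at h2
  obtain ⟨s, hsε, hs⟩ := ((h2.eventually_lt_const hε).and
    (Ioo_mem_nhdsLT (zero_lt_one (α := ℝ)))).exists
  have has : |s| < 1 := by rw [abs_of_pos hs.1]; exact hs.2
  have hI := Ioo_mem_nhdsLT (zero_lt_one (α := ℝ))
  have hlim : Tendsto (fun r : ℝ => totalDefect φ r s) (𝓝[<] 1)
      (𝓝 (∫ b in (0 : ℝ)..2 * Real.pi, 2 * Real.pi * ((1 - s ^ 2) *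
        ‖neumann (block₂₂ (block₂₂ V)) (s * Complex.exp (b * Complex.I))
          (snd (block₂₁ V 1))‖ ^ 2))) := by
    refine intervalIntegral.tendsto_integral_filter_of_dominated_convergence
      (fun _ => 1 * |2 * Real.pi - 0|) ?_ ?_ intervalIntegrable_const
      (Eventually.of_forall fun b _ =>
        tendsto_integral_defect hφ hV hτ hD₂₁ hD₁ hD₃ hs.1.le hs.2 b)
    · filter_upwards [hI] with r hr
      have har : |r| < 1 := by rw [abs_of_pos hr.1]; exact hr.2
      exact (continuous_integral_defect_left hφ har has).aestronglyMeasurable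
    · filter_upwards [hI] with r hr
      have har : |r| < 1 := by rw [abs_of_pos hr.1]; exact hr.2
      refine Eventually.of_forall fun b _ =>
        intervalIntegral.norm_integral_le_of_norm_le_const fun a _ => ?_
      have := defect_mem_Icc hφ har has a b
      rw [Real.norm_eq_abs, abs_of_nonneg this.1]
      exact this.2
  rw [intervalIntegral.integral_const_mul, intervalIntegral.integral_const_mul] at hlim
  obtain ⟨r, hrε, hr⟩ := ((hlim.eventually_lt_const hsε).and hI).exists
  exact ⟨r, hr, s, hs, hrε⟩

end Realization

end Bidisc

theorem mainTheorem1 {H₁ H₂ : Type*}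
    [NormedAddCommGroup H₁] [InnerProductSpace ℂ H₁] [CompleteSpace H₁]
    [NormedAddCommGroup H₂] [InnerProductSpace ℂ H₂] [CompleteSpace H₂]
    (φ : ℂ × ℂ → ℂ) (hφ : Bidisc.IsSchur φ)
    (V : WithLp 2 (ℂ × WithLp 2 (H₁ × H₂)) →L[ℂ] WithLp 2 (ℂ × WithLp 2 (H₁ × H₂)))
    (hV : Isometry V)
    (hτ : ∀ z ∈ Bidisc.bidisc, φ z = Bidisc.transfer V z)
    (hD₂₁ : Bidisc.block₂₁ (Bidisc.block₂₂ V) = 0)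
    (hD₁ : Bidisc.IsC0 (Bidisc.block₁₁ (Bidisc.block₂₂ V)))
    (hD₃ : Bidisc.IsC0 (Bidisc.block₂₂ (Bidisc.block₂₂ V))) :
    Bidisc.IsInner φ := by
  exact Bidisc.isInner_of_totalDefect_small hφ fun _ hε =>
    Bidisc.exists_totalDefect_lt hφ hV hτ hD₂₁ hD₁ hD₃ hε
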